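/- ($\mathbb{Z}_2$ synchronization.) For $p\ge 1$, $\lambda^*\in\mathbb{R}$ and $z^*\in\{-1,1\}^p$ one observes $Y=\lambda^* z^*z^{*T}+W\in\mathbb{R}^{p\times p}$, where $W$ is symmetric with zero diagonal and the entries $W_{ij}$, $1\le i<j\le p$, are independent $\mathcal N(0,1)$ variables. For $z\in\{-1,1\}^p$ put $\widehat\beta(z)=\frac{z^TYz}{p^2}z$ and let $$\ell(z,z^*)=\sum_{j=1}^p (z_j-z_j^*)^2\|\lambda^*z^*\|^2=p\lambda^{*2}\sum_{j=1}^p(z_j-z_j^*)^2 .$$ Given a random initial vector $z^{(0)}\in\{-1,1\}^p$ (which may depend on $Y$), define for $t\ge1$ $$z_j^{(t)}=\mathop{\rm argmin}_{a\in\{-1,1\}}\|Y_j-a\,\widehat\beta(z^{(t-1)})\|^2,\qquad j=1,\dots,p,$$ where $Y_j$ is the $j$th column of $Y$ and ties are broken arbitrarily; equivalently, $z_j^{(t)}={\rm sign}(Y_j^Tz^{(t-1)})$ if $(z^{(t-1)})^TYz^{(t-1)}\ge0$ and $z_j^{(t)}=-{\rm sign}(Y_j^Tz^{(t-1)})$ otherwise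 (up to ties). Consider a sequence of such models, the quantities $p,\lambda^*,z^*,z^{(0)},\eta$ depending on the index, with $p\lambda^{*2}\to\infty$, and suppose that $z^{(0)}$ satisfies $\ell(z^{(0)},z^*)=o(p^2\lambda^{*2})$ with probability at least $1-\eta$; that is, $\ell(z^{(0)},z^*)\le\tau$ with probability at least $1-\eta$ for some deterministic sequence $\tau=o(p^2\lambda^{*2})$. Then $$\ell(z^{(t)},z^*)\le p\exp\left(-(1+o(1))\frac{p\lambda^{*2}}{2}\right)+\frac12\,\ell(z^{(t-1)},z^*)\qquad\text{for all }t\ge1$$ simultaneously, with probability at least $1-\eta-\exp(-\sqrt{p\lambda^{*2}})-e^{-p}$. Here $o(1)$ is a deterministic sequence tending to $0$ that depends only on the sequences $p$, $\lambda^*$ and $\tau$. -/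

import Mathlib

open MeasureTheory ProbabilityTheory Filter Topology Asymptotics

namespace Z2Sync

noncomputable section

/-- Squared Euclidean norm of a vector. -/
def sqNorm {p : ℕ} (v : Fin p → ℝ) : ℝ := ∑ i, v i ^ 2

/-- The vector `z` has all its entries in `{-1, 1}`. -/
def IsLabel {p : ℕ} (z : Fin p → ℝ) : Prop := ∀ j, z j = 1 ∨ z j = -1

/-- `W` is a symmetric random matrix with zero diagonal whose entries above the diagonal are
independent standard Gaussian random variables. -/
structure IsGaussianNoise {Ω : Type*} [MeasurableSpace Ω] (μ : Measure Ω) {p : ℕ}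
    (W : Ω → Matrix (Fin p) (Fin p) ℝ) : Prop where
  symm : ∀ ω i j, W ω i j = W ω j i
  diag : ∀ ω i, W ω i i = 0
  measurable : ∀ i j, Measurable fun ω => W ω i j
  law : ∀ i j, i < j → μ.map (fun ω => W ω i j) = gaussianReal 0 1
  indep : iIndepFun (fun (e : {e : Fin p × Fin p // e.1 < e.2}) (ω : Ω) => W ω e.1.1 e.1.2) μ

/-- The observation `Y = lam • zs zsᵀ + W`. -/
def observation {p : ℕ} (lam : ℝ) (zs : Fin p → ℝ) (W : Matrix (Fin p) (Fin p) ℝ) :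
    Matrix (Fin p) (Fin p) ℝ :=
  lam • Matrix.vecMulVec zs zs + W

/-- `β̂(z) = (zᵀ Y z / p²) z`. -/
def betaHat {p : ℕ} (Y : Matrix (Fin p) (Fin p) ℝ) (z : Fin p → ℝ) : Fin p → ℝ :=
  ((z ⬝ᵥ Matrix.mulVec Y z) / (p : ℝ) ^ 2) • z

/-- `z'` is a next iterate after `z`: each `z' j` minimizes `‖Y_j - a β̂(z)‖²` over `a ∈ {-1, 1}`,
where `Y_j` is the `j`-th column of `Y`. Ties may be broken in any way. -/
def IsUpdate {p : ℕ} (Y : Matrix (Fin p) (Fin p) ℝ) (z z' : Fin p → ℝ) : Prop :=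
  ∀ j, (z' j = 1 ∨ z' j = -1) ∧
    ∀ a : ℝ, (a = 1 ∨ a = -1) →
      sqNorm (fun i => Y i j - z' j * betaHat Y z i) ≤ sqNorm (fun i => Y i j - a * betaHat Y z i)

/-- The loss `ℓ(z, zs) = ∑ j, ‖z_j β* - zs_j β*‖²`, where `β* = lam • zs`. -/
def loss {p : ℕ} (lam : ℝ) (z zs : Fin p → ℝ) : ℝ :=
  ∑ j, sqNorm (fun i => z j * (lam * zs i) - zs j * (lam * zs i))

end

end Z2Sync

/-! Write `x = p λ²`, let `s` be the sign of `λ`, and measure errors by the number of mismatched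
labels; the loss is `4x` times that number. Let `δ` be the `radius`. If `z` has at most `δp/4`
mismatches, the signal fixes the sign of `zᵀYz` to be `s`, and coordinate `j` can be updated wrongly
only if the noise `-(s zs_j)(Wz)_j` reaches `(1 - δ/2)|λ|p`. Split `Wz = W zs + W(z - zs)`: one of
the two parts must reach its share `(1 - δ)|λ|p` or `(δ/2)|λ|p`.

The first share does not involve `z`. By the Gaussian tail and Markov's inequality, fewer than `p
exp(√x - (1-δ)² x/2)` coordinates reach it, except with probability `exp(-√x)`
(`measureReal_exceedCount_ge_le`). The second is reached by at most half as many coordinates as `z`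
has mismatches, once `W` is bounded on all ternary vectors, which fails with probability at most
`exp(-p)` (`TernaryBound.card_le`).

Neither good event depends on the iterates, so both serve every `t` and any data-dependent start,
and the bound `δp/4` propagates by induction. The `o(1)` absorbs `δ`, `√x` and the factor `4x`. -/

namespace Z2Sync

open Matrix

/-! ### Gaussian tails of bilinear forms in the noise -/

/-- A sum over ordered pairs of a symmetric function, split into the diagonal and twice the part
above the diagonal. -/
lemma sum_sum_eq_diag_add_two_mul {p : ℕ} (f : Fin p → Fin p → ℝ) (hf : ∀ i j, f i j = f j i) :
    ∑ i, ∑ j, f i j =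
      ∑ i, f i i + 2 * ∑ e : {e : Fin p × Fin p // e.1 < e.2}, f e.1.1 e.1.2 := by
  have hpair : ∑ e : {e : Fin p × Fin p // e.1 < e.2}, f e.1.1 e.1.2 =
      ∑ i, ∑ j, if i < j then f i j else 0 := by
    rw [← Finset.sum_subtype_eq_sum_filter (p := fun e : Fin p × Fin p => e.1 < e.2)
      (s := Finset.univ) (f := fun e => f e.1 e.2) |>.trans (Finset.sum_filter _ _) |>.trans
      (Fintype.sum_prod_type _)]
    simp
  have hswap : ∑ i, ∑ j, (if i < j then f i j else 0) =
      ∑ i, ∑ j, if j < i then f i j else 0 := by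
    rw [Finset.sum_comm]
    refine Finset.sum_congr rfl fun i _ => Finset.sum_congr rfl fun j _ => ?_
    rw [hf]
  have hdiag : ∑ i, f i i = ∑ i, ∑ j, if i = j then f i j else 0 := by simp
  rw [two_mul, hpair]
  nth_rewrite 2 [hswap]
  rw [hdiag, ← Finset.sum_add_distrib, ← Finset.sum_add_distrib]
  refine Finset.sum_congr rfl fun i _ => ?_
  rw [← Finset.sum_add_distrib, ← Finset.sum_add_distrib]
  refine Finset.sum_congr rfl fun j _ => ?_
  rcases lt_trichotomy i j with h | h | h
  · simp [h, h.ne, h.not_gt]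
  · simp [h]
  · simp [h, h.ne', h.not_gt]

/-- Only the entries above the diagonal are independent, so the form is expressed through them
alone. -/
lemma dotProduct_mulVec_eq_sum_pairs {p : ℕ} {W : Matrix (Fin p) (Fin p) ℝ}
    (hs : ∀ i j, W i j = W j i) (hd : ∀ i, W i i = 0) (u v : Fin p → ℝ) :
    u ⬝ᵥ W *ᵥ v = ∑ e : {e : Fin p × Fin p // e.1 < e.2},
      (u e.1.1 * v e.1.2 + u e.1.2 * v e.1.1) * W e.1.1 e.1.2 := by
  have h := sum_sum_eq_diag_add_two_mul (fun i j => (u i * v j + u j * v i) * W i j)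
    (fun i j => by rw [hs i j]; ring)
  have h1 : u ⬝ᵥ W *ᵥ v = ∑ i, ∑ j, u i * v j * W i j := by
    simp only [dotProduct, mulVec, Finset.mul_sum]
    exact Finset.sum_congr rfl fun i _ => Finset.sum_congr rfl fun j _ => by ring
  have h2 : u ⬝ᵥ W *ᵥ v = ∑ i, ∑ j, u j * v i * W i j := by
    rw [h1, Finset.sum_comm]
    exact Finset.sum_congr rfl fun i _ => Finset.sum_congr rfl fun j _ => by rw [hs j i]
  have h3 : ∑ i, ∑ j, (u i * v j + u j * v i) * W i j = u ⬝ᵥ W *ᵥ v + u ⬝ᵥ W *ᵥ v := by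
    nth_rewrite 1 [h1]
    rw [h2, ← Finset.sum_add_distrib]
    refine Finset.sum_congr rfl fun i _ => ?_
    rw [← Finset.sum_add_distrib]
    exact Finset.sum_congr rfl fun j _ => by ring
  simp only [hd, mul_zero, Finset.sum_const_zero, zero_add] at h
  linarith

/-- This is the variance of the bilinear form `uᵀWv`. -/
lemma sum_pairs_sq {p : ℕ} (u v : Fin p → ℝ) :
    ∑ e : {e : Fin p × Fin p // e.1 < e.2}, (u e.1.1 * v e.1.2 + u e.1.2 * v e.1.1) ^ 2 =
      sqNorm u * sqNorm v + (u ⬝ᵥ v) ^ 2 - 2 * ∑ i, u i ^ 2 * v i ^ 2 := by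
  have h := sum_sum_eq_diag_add_two_mul (fun i j => (u i * v j + u j * v i) ^ 2)
    (fun i j => by ring)
  have h1 : ∑ i, ∑ j, (u i * v j + u j * v i) ^ 2 =
      2 * (sqNorm u * sqNorm v) + 2 * (u ⬝ᵥ v) ^ 2 := by
    have e1 : sqNorm u * sqNorm v = ∑ i, ∑ j, u i ^ 2 * v j ^ 2 := by
      rw [sqNorm, sqNorm, Finset.sum_mul_sum]
    have e2 : sqNorm u * sqNorm v = ∑ i, ∑ j, u j ^ 2 * v i ^ 2 := by
      rw [e1, Finset.sum_comm]
    have e3 : (u ⬝ᵥ v) ^ 2 = ∑ i, ∑ j, (u i * v i) * (u j * v j) := by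
      rw [sq, dotProduct, Finset.sum_mul_sum]
    have e4 : ∑ i, ∑ j, (u i * v j + u j * v i) ^ 2 = ∑ i, ∑ j, u i ^ 2 * v j ^ 2 +
        ∑ i, ∑ j, u j ^ 2 * v i ^ 2 + 2 * ∑ i, ∑ j, (u i * v i) * (u j * v j) := by
      simp only [Finset.mul_sum, ← Finset.sum_add_distrib]
      exact Finset.sum_congr rfl fun i _ => Finset.sum_congr rfl fun j _ => by ring
    rw [e4, ← e1, ← e2, ← e3]
    ring
  have h2 : ∑ i, (u i * v i + u i * v i) ^ 2 = 4 * ∑ i, u i ^ 2 * v i ^ 2 := by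
    rw [Finset.mul_sum]
    exact Finset.sum_congr rfl fun i _ => by ring
  rw [h1, h2] at h
  linarith

/-- A standard Gaussian random variable is sub-Gaussian with variance proxy `1`. -/
lemma hasSubgaussianMGF_of_map_eq_gaussianReal {Ω : Type*} [MeasurableSpace Ω] {μ : Measure Ω}
    {X : Ω → ℝ} (hX : Measurable X) (hlaw : μ.map X = gaussianReal 0 1) :
    HasSubgaussianMGF X 1 μ where
  integrable_exp_mul t := by
    have := integrable_exp_mul_gaussianReal (μ := 0) (v := 1) t
    rw [← hlaw] at this
    exact this.comp_measurable hX
  mgf_le t := by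
    rw [mgf_gaussianReal hlaw]
    simp

variable {Ω : Type*} [MeasurableSpace Ω] {μ : Measure Ω} {p : ℕ}
  {W : Ω → Matrix (Fin p) (Fin p) ℝ}

lemma IsGaussianNoise.measurable_dotProduct_mulVec (hW : IsGaussianNoise μ W) (u v : Fin p → ℝ) :
    Measurable fun ω => u ⬝ᵥ W ω *ᵥ v := by
  simp only [dotProduct, mulVec]
  have := hW.measurable
  fun_prop

/-- Gaussian tail bound for the bilinear form of the noise matrix. -/
lemma IsGaussianNoise.measureReal_dotProduct_mulVec_ge_le [IsProbabilityMeasure μ]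
    (hW : IsGaussianNoise μ W) (u v : Fin p → ℝ) {c ε : ℝ}
    (hcv : sqNorm u * sqNorm v + (u ⬝ᵥ v) ^ 2 - 2 * ∑ i, u i ^ 2 * v i ^ 2 ≤ c) (hε : 0 ≤ ε) :
    μ.real {ω | ε ≤ u ⬝ᵥ W ω *ᵥ v} ≤ Real.exp (-ε ^ 2 / (2 * c)) := by
  let a (e : {e : Fin p × Fin p // e.1 < e.2}) : ℝ := u e.1.1 * v e.1.2 + u e.1.2 * v e.1.1
  let V (e : {e : Fin p × Fin p // e.1 < e.2}) : NNReal := Real.toNNReal (a e ^ 2)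
  have hsub (e : {e : Fin p × Fin p // e.1 < e.2}) :
      HasSubgaussianMGF (fun ω => a e * W ω e.1.1 e.1.2) (V e) μ := by
    convert (hasSubgaussianMGF_of_map_eq_gaussianReal (hW.measurable _ _)
      (hW.law _ _ e.2)).const_mul (a e) using 1
    ext
    exact (Real.coe_toNNReal _ (sq_nonneg _)).trans (mul_one (a e ^ 2)).symm
  have hind : iIndepFun (fun (e : {e : Fin p × Fin p // e.1 < e.2}) (ω : Ω) =>
      a e * W ω e.1.1 e.1.2) μ :=
    hW.indep.comp (fun e x => a e * x) fun e => measurable_const_mul _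
  have hsum := HasSubgaussianMGF.sum_of_iIndepFun hind (s := Finset.univ) fun e _ => hsub e
  have htail := hsum.measure_ge_le hε
  have hset : {ω | ε ≤ u ⬝ᵥ W ω *ᵥ v} = {ω | ε ≤ ∑ e, a e * W ω e.1.1 e.1.2} := by
    ext ω
    simp only [Set.mem_ofPred_eq, a]
    rw [dotProduct_mulVec_eq_sum_pairs (hW.symm ω) (hW.diag ω)]
  have hvar : ((∑ e, V e : NNReal) : ℝ) ≤ c := by
    rw [← sum_pairs_sq] at hcv
    refine le_trans (le_of_eq ?_) hcv
    rw [NNReal.coe_sum]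
    exact Finset.sum_congr rfl fun e _ => Real.coe_toNNReal _ (sq_nonneg _)
  rcases hε.eq_or_lt with rfl | hε
  · simp [measureReal_le_one]
  rw [hset]
  -- At zero variance the quotient in `htail` is `0` by convention and the bound is vacuous; there
  -- the form vanishes almost surely.
  rcases eq_or_ne (∑ e, V e) 0 with hV | hV
  · rw [hV] at hsum
    have h0 := hsum.ae_eq_zero_of_hasSubgaussianMGF_zero
    have : μ {ω | ε ≤ ∑ e, a e * W ω e.1.1 e.1.2} = 0 := by
      rw [← compl_mem_ae_iff]
      filter_upwards [h0] with ω hω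
      simp [hω, hε]
    simpa [measureReal_def, this] using (Real.exp_pos _).le
  · have hVpos : (0 : ℝ) < (∑ e, V e : NNReal) := by exact_mod_cast pos_iff_ne_zero.2 hV
    refine htail.trans (Real.exp_le_exp.2 ?_)
    rw [neg_div, neg_div, neg_le_neg_iff]
    gcongr

lemma sq_dotProduct_le (u v : Fin p → ℝ) : (u ⬝ᵥ v) ^ 2 ≤ sqNorm u * sqNorm v :=
  Finset.sum_mul_sq_le_sq_mul_sq _ _ _

lemma sqNorm_nonneg (u : Fin p → ℝ) : 0 ≤ sqNorm u := Finset.sum_nonneg fun _ _ => sq_nonneg _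

/-! ### Uniform noise bound on ternary vectors -/

/-- The vectors with entries in `{-1, 0, 1}`. -/
noncomputable def ternary (p : ℕ) : Finset (Fin p → ℝ) :=
  Fintype.piFinset fun _ => {-1, 0, 1}

lemma card_ternary (p : ℕ) : (ternary p).card = 3 ^ p := by
  have : ({-1, 0, 1} : Finset ℝ).card = 3 := by
    rw [Finset.card_eq_three]
    exact ⟨-1, 0, 1, by norm_num, by norm_num, by norm_num, rfl⟩
  simp [ternary, this]

/-- The matrix `W` has bilinear form at most `4 √p ‖u‖ ‖v‖` on vectors with entries in
`{-1, 0, 1}`. -/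
def TernaryBound (W : Matrix (Fin p) (Fin p) ℝ) : Prop :=
  ∀ u ∈ ternary p, ∀ v ∈ ternary p,
    u ⬝ᵥ W *ᵥ v ≤ 4 * √(p : ℝ) * (√(sqNorm u) * √(sqNorm v))

/-- By Cauchy–Schwarz the variance is at most `2‖u‖²‖v‖²`, and `16p / (2 · 2) = 4p`. The strict
inequality makes the event empty when `u` or `v` is zero. -/
lemma IsGaussianNoise.measureReal_ternary_gt_le [IsProbabilityMeasure μ]
    (hW : IsGaussianNoise μ W) (u v : Fin p → ℝ) :
    μ.real {ω | 4 * √(p : ℝ) * (√(sqNorm u) * √(sqNorm v)) < u ⬝ᵥ W ω *ᵥ v} ≤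
      Real.exp (-(4 * p)) := by
  rcases (mul_nonneg (sqNorm_nonneg u) (sqNorm_nonneg v)).eq_or_lt with h | h
  · have h0 (ω : Ω) : u ⬝ᵥ W ω *ᵥ v = 0 := by
      rcases mul_eq_zero.1 h.symm with h | h
      · have : u = 0 := funext fun i => by
          simpa using (Finset.sum_eq_zero_iff_of_nonneg fun i _ => sq_nonneg (u i)).1 h i
        simp [this]
      · have : v = 0 := funext fun i => by
          simpa using (Finset.sum_eq_zero_iff_of_nonneg fun i _ => sq_nonneg (v i)).1 h i
        simp [this]
    have : {ω | 4 * √(p : ℝ) * (√(sqNorm u) * √(sqNorm v)) < u ⬝ᵥ W ω *ᵥ v} = ∅ := by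
      ext ω
      simp only [h0, Set.mem_ofPred_eq, Set.mem_empty_iff_false, iff_false, not_lt]
      positivity
    rw [this]
    simpa using (Real.exp_pos _).le
  · have htail := hW.measureReal_dotProduct_mulVec_ge_le u v (c := 2 * (sqNorm u * sqNorm v))
      (ε := 4 * √(p : ℝ) * (√(sqNorm u) * √(sqNorm v)))
      (by
        have h1 := sq_dotProduct_le u v
        have h2 : 0 ≤ ∑ i, u i ^ 2 * v i ^ 2 := Finset.sum_nonneg fun _ _ => by positivity
        linarith) (by positivity)
    refine (measureReal_mono (Set.ofPred_subset_ofPred.2 fun ω hω => le_of_lt hω)).trans (htail.trans (le_of_eq ?_))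
    congr 1
    rw [mul_pow, mul_pow, mul_pow, Real.sq_sqrt (Nat.cast_nonneg p),
      Real.sq_sqrt (sqNorm_nonneg u), Real.sq_sqrt (sqNorm_nonneg v)]
    have hu := left_ne_zero_of_mul h.ne'
    have hv := right_ne_zero_of_mul h.ne'
    field_simp
    ring

/-- Union bound over `9 ^ p` pairs: since `9 ≤ e³`, it uses up `3p` of the exponent `4p`. -/
lemma IsGaussianNoise.measureReal_not_ternaryBound_le [IsProbabilityMeasure μ]
    (hW : IsGaussianNoise μ W) :
    μ.real {ω | ¬ TernaryBound (W ω)} ≤ Real.exp (-(p : ℝ)) := by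
  have hsub : {ω | ¬ TernaryBound (W ω)} ⊆ ⋃ w ∈ ternary p ×ˢ ternary p,
      {ω | 4 * √(p : ℝ) * (√(sqNorm w.1) * √(sqNorm w.2)) < w.1 ⬝ᵥ W ω *ᵥ w.2} := by
    intro ω hω
    simp only [TernaryBound, Set.mem_ofPred_eq, not_forall, not_le] at hω
    obtain ⟨u, hu, v, hv, h⟩ := hω
    simp only [Set.mem_iUnion]
    exact ⟨(u, v), Finset.mem_product.2 ⟨hu, hv⟩, h⟩
  calc _ ≤ _ := measureReal_mono hsub (measure_ne_top _ _)
    _ ≤ _ := measureReal_biUnion_finset_le _ _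
    _ ≤ ∑ w ∈ ternary p ×ˢ ternary p, Real.exp (-(4 * p)) :=
      Finset.sum_le_sum fun w _ => hW.measureReal_ternary_gt_le w.1 w.2
    _ = 9 ^ p * Real.exp (-(4 * p)) := by
      rw [Finset.sum_const, Finset.card_product, card_ternary, ← mul_pow]
      simp
    _ ≤ Real.exp 3 ^ p * Real.exp (-(4 * p)) := by
      gcongr
      have h2 : (2.7182818283 : ℝ) < Real.exp 1 := Real.exp_one_gt_d9
      have h3 : Real.exp 3 = Real.exp 1 ^ 3 := by rw [← Real.exp_nat_mul]; norm_num
      rw [h3]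
      calc (9 : ℝ) ≤ 2.7182818283 ^ 3 := by norm_num
        _ ≤ _ := by gcongr
    _ = Real.exp (-(p : ℝ)) := by
      rw [← Real.exp_nat_mul, ← Real.exp_add]
      congr 1
      ring

/-! ### Coordinates with large noise at the true labels -/

lemma IsLabel.sq_eq_one {z : Fin p → ℝ} (hz : IsLabel z) (j : Fin p) : z j ^ 2 = 1 := by
  rcases hz j with h | h <;> simp [h]

lemma IsLabel.sqNorm_eq {z : Fin p → ℝ} (hz : IsLabel z) : sqNorm z = p := by
  simp [sqNorm, hz.sq_eq_one]

open Classical in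
/-- The number of coordinates on which the noise, seen from the true labels, exceeds `b`. -/
noncomputable def exceedCount (s : ℝ) (zs : Fin p → ℝ) (b : ℝ) (W : Matrix (Fin p) (Fin p) ℝ) : ℝ :=
  ((Finset.univ.filter fun j => b ≤ -(s * zs j) * (W *ᵥ zs) j).card : ℝ)

/-- For a signed basis vector against `zs` the variance is `p + 1 - 2 = p - 1`, thanks to the zero
diagonal. -/
lemma IsGaussianNoise.measureReal_coord_ge_le [IsProbabilityMeasure μ]
    (hW : IsGaussianNoise μ W) {zs : Fin p → ℝ} (hzs : IsLabel zs) {s : ℝ} (hs : s ^ 2 = 1)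
    {b : ℝ} (hb : 0 ≤ b) (j : Fin p) :
    μ.real {ω | b ≤ -(s * zs j) * (W ω *ᵥ zs) j} ≤ Real.exp (-b ^ 2 / (2 * p)) := by
  have h1 : (s * zs j) ^ 2 = 1 := by rw [mul_pow, hs, hzs.sq_eq_one, one_mul]
  have := hW.measureReal_dotProduct_mulVec_ge_le (Pi.single j (-(s * zs j))) zs (c := p)
    (by
      have h2 : sqNorm (Pi.single j (-(s * zs j))) = 1 := by
        rw [sqNorm, Finset.sum_eq_single j (fun i _ hi => by simp [hi]) (by simp)]
        simpa using h1
      have h3 : ∑ i, (Pi.single j (-(s * zs j)) : Fin p → ℝ) i ^ 2 * zs i ^ 2 = 1 := by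
        rw [← h2, sqNorm]
        exact Finset.sum_congr rfl fun i _ => by rw [hzs.sq_eq_one, mul_one]
      rw [h2, h3, hzs.sqNorm_eq, single_dotProduct, mul_pow, neg_sq, h1, hzs.sq_eq_one]
      linarith) hb
  simpa only [single_dotProduct] using this

/-- Markov's inequality needs only the expected count, so the dependence between rows of `W` is
harmless. -/
lemma IsGaussianNoise.measureReal_exceedCount_ge_le [IsProbabilityMeasure μ]
    (hW : IsGaussianNoise μ W) {zs : Fin p → ℝ} (hzs : IsLabel zs) {s : ℝ} (hs : s ^ 2 = 1)
    {b : ℝ} (hb : 0 ≤ b) (hp : 0 < p) (y : ℝ) :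
    μ.real {ω | p * Real.exp (y - b ^ 2 / (2 * p)) ≤ exceedCount s zs b (W ω)} ≤
      Real.exp (-y) := by
  classical
  let E (j : Fin p) : Set Ω := {ω | b ≤ -(s * zs j) * (W ω *ᵥ zs) j}
  have hE (j : Fin p) : MeasurableSet (E j) := by
    have h := hW.measurable
    refine measurableSet_le measurable_const ?_
    simp only [mulVec, dotProduct]
    fun_prop
  have hcount : (fun ω => exceedCount s zs b (W ω)) =
      fun ω => ∑ j, (E j).indicator (fun _ => (1 : ℝ)) ω := by
    ext ω
    simp only [exceedCount, Finset.card_filter, Nat.cast_sum, Set.indicator_apply, E,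
      Set.mem_ofPred_eq]
    exact Finset.sum_congr rfl fun j _ => by split_ifs <;> simp
  have hint (j : Fin p) : Integrable ((E j).indicator fun _ => (1 : ℝ)) μ :=
    (integrable_const _).indicator (hE j)
  have hmean : ∫ ω, exceedCount s zs b (W ω) ∂μ ≤ p * Real.exp (-b ^ 2 / (2 * p)) := by
    rw [hcount, integral_finsetSum _ fun j _ => hint j]
    calc _ = ∑ j, μ.real (E j) := by
          refine Finset.sum_congr rfl fun j _ => ?_
          rw [integral_indicator_const _ (hE j)]
          simp
      _ ≤ ∑ j : Fin p, Real.exp (-b ^ 2 / (2 * p)) :=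
          Finset.sum_le_sum fun j _ => hW.measureReal_coord_ge_le hzs hs hb j
      _ = _ := by simp
  have hmarkov := mul_meas_ge_le_integral_of_nonneg (μ := μ)
    (f := fun ω => exceedCount s zs b (W ω)) (Eventually.of_forall fun ω => Nat.cast_nonneg _)
    (by rw [hcount]; exact integrable_finsetSum _ fun j _ => hint j)
    (p * Real.exp (y - b ^ 2 / (2 * p)))
  have hp' : (0 : ℝ) < p := by exact_mod_cast hp
  have hpos : (0 : ℝ) < p * Real.exp (y - b ^ 2 / (2 * p)) := by positivity
  rw [← mul_le_mul_iff_right₀ hpos]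
  refine hmarkov.trans (hmean.trans (le_of_eq ?_))
  rw [mul_assoc, ← Real.exp_add]
  congr 2
  ring

/-! ### Mismatches and the loss -/

open Classical in
/-- The number of coordinates on which two label vectors differ. -/
noncomputable def mismatch (z zs : Fin p → ℝ) : ℝ :=
  ((Finset.univ.filter fun j => z j ≠ zs j).card : ℝ)

lemma mismatch_nonneg (z zs : Fin p → ℝ) : 0 ≤ mismatch z zs := Nat.cast_nonneg _

lemma mismatch_le (z zs : Fin p → ℝ) : mismatch z zs ≤ p := by
  have := Finset.card_filter_le (Finset.univ : Finset (Fin p)) (fun j => z j ≠ zs j)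
  rw [Finset.card_univ, Fintype.card_fin] at this
  rw [mismatch]
  exact_mod_cast this

lemma mismatch_eq_sum (z zs : Fin p → ℝ) : mismatch z zs = ∑ j, if z j = zs j then 0 else 1 := by
  classical
  rw [mismatch, Finset.card_filter, Nat.cast_sum]
  exact Finset.sum_congr rfl fun j _ => by split_ifs <;> simp_all

lemma IsLabel.sq_sub {z zs : Fin p → ℝ} (hz : IsLabel z) (hzs : IsLabel zs) (j : Fin p) :
    (z j - zs j) ^ 2 = 4 * if z j = zs j then 0 else 1 := by
  rcases hz j with h | h <;> rcases hzs j with h' | h' <;> rw [h, h'] <;> norm_num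

lemma IsLabel.mul_eq {z zs : Fin p → ℝ} (hz : IsLabel z) (hzs : IsLabel zs) (j : Fin p) :
    zs j * z j = 1 - 2 * if z j = zs j then 0 else 1 := by
  rcases hz j with h | h <;> rcases hzs j with h' | h' <;> rw [h, h'] <;> norm_num

lemma IsLabel.loss_eq {z zs : Fin p → ℝ} (hz : IsLabel z) (hzs : IsLabel zs) (lam : ℝ) :
    loss lam z zs = 4 * (p * lam ^ 2) * mismatch z zs := by
  rw [mismatch_eq_sum, Finset.mul_sum, loss]
  refine Finset.sum_congr rfl fun j _ => ?_
  have : ∀ i, (z j * (lam * zs i) - zs j * (lam * zs i)) ^ 2 = lam ^ 2 * (z j - zs j) ^ 2 := by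
    intro i
    have := hzs.sq_eq_one i
    linear_combination (lam ^ 2 * (z j - zs j) ^ 2) * this
  simp only [sqNorm, this, Finset.sum_const, Finset.card_univ, Fintype.card_fin, nsmul_eq_mul,
    hz.sq_sub hzs]
  ring

lemma IsLabel.dotProduct_eq {z zs : Fin p → ℝ} (hz : IsLabel z) (hzs : IsLabel zs) :
    zs ⬝ᵥ z = p - 2 * mismatch z zs := by
  simp only [mismatch_eq_sum, Finset.mul_sum, dotProduct, hz.mul_eq hzs, Finset.sum_sub_distrib,
    Finset.sum_const, Finset.card_univ, Fintype.card_fin, nsmul_eq_mul, mul_one]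

lemma IsLabel.mem_ternary {z : Fin p → ℝ} (hz : IsLabel z) : z ∈ ternary p := by
  rw [ternary, Fintype.mem_piFinset]
  intro j
  rcases hz j with h | h <;> simp [h]

/-! ### One step of the algorithm -/

lemma IsUpdate.isLabel {Y : Matrix (Fin p) (Fin p) ℝ} {z z' : Fin p → ℝ} (h : IsUpdate Y z z') :
    IsLabel z' := fun j => (h j).1

/-- If the estimated signal has sign `s`, an updated label agrees with `s * (Yᵀ z) j`. -/
lemma IsUpdate.nonneg {Y : Matrix (Fin p) (Fin p) ℝ} {z z' : Fin p → ℝ} (h : IsUpdate Y z z')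
    {s : ℝ} (hs : 0 < s * (z ⬝ᵥ Y *ᵥ z)) (j : Fin p) :
    0 ≤ s * z' j * ∑ i, Y i j * z i := by
  have hp : (0 : ℝ) < p := by exact_mod_cast j.pos
  set q := z ⬝ᵥ Y *ᵥ z
  obtain ⟨hl, hmin⟩ := h j
  -- Against the opposite label the quadratic terms cancel, leaving the sign of the cross term.
  have hmin := hmin (-(z' j)) (by rcases hl with h | h <;> simp [h])
  have hexp (a : ℝ) : sqNorm (fun i => Y i j - a * betaHat Y z i) =
      ∑ i, Y i j ^ 2 - 2 * a * (q / p ^ 2 * ∑ i, Y i j * z i) +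
        a ^ 2 * ∑ i, betaHat Y z i ^ 2 := by
    simp only [sqNorm, Finset.mul_sum, ← Finset.sum_sub_distrib, ← Finset.sum_add_distrib]
    refine Finset.sum_congr rfl fun i _ => ?_
    simp only [betaHat, Pi.smul_apply, smul_eq_mul, q]
    ring
  rw [hexp, hexp] at hmin
  set S := ∑ i, Y i j * z i
  have h1 : 0 ≤ (z' j * S * q) / p ^ 2 := by
    have : z' j * (q / p ^ 2 * S) = (z' j * S * q) / p ^ 2 := by ring
    nlinarith
  have h2 : 0 ≤ z' j * S * q := by
    have := mul_nonneg h1 (sq_nonneg (p : ℝ))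
    rwa [div_mul_cancel₀ _ (by positivity)] at this
  have h3 : 0 ≤ (s * z' j * S) * (s * q) := by
    have : (s * z' j * S) * (s * q) = s ^ 2 * (z' j * S * q) := by ring
    rw [this]
    positivity
  exact nonneg_of_mul_nonneg_left h3 hs

lemma dotProduct_observation_mulVec (lam : ℝ) (zs : Fin p → ℝ) (W : Matrix (Fin p) (Fin p) ℝ)
    (z : Fin p → ℝ) :
    z ⬝ᵥ observation lam zs W *ᵥ z = lam * (zs ⬝ᵥ z) ^ 2 + z ⬝ᵥ W *ᵥ z := by
  rw [observation, add_mulVec, dotProduct_add, smul_mulVec, vecMulVec_mulVec, dotProduct_smul,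
    op_smul_eq_smul, dotProduct_smul, dotProduct_comm z zs]
  simp only [smul_eq_mul]
  ring

lemma sum_observation_mul {W : Matrix (Fin p) (Fin p) ℝ} (hW : ∀ i j, W i j = W j i) (lam : ℝ)
    (zs z : Fin p → ℝ) (j : Fin p) :
    ∑ i, observation lam zs W i j * z i = lam * zs j * (zs ⬝ᵥ z) + (W *ᵥ z) j := by
  simp only [observation, dotProduct, mulVec, Finset.mul_sum, ← Finset.sum_add_distrib]
  refine Finset.sum_congr rfl fun i _ => ?_
  rw [Matrix.add_apply, Matrix.smul_apply, vecMulVec_apply, hW i j, smul_eq_mul]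
  ring

/-- Under the uniform bound on the noise, a coordinate that is misclassified although its own noise
is moderate must feel the errors of the previous iterate; there are few such coordinates. -/
lemma TernaryBound.card_le {W : Matrix (Fin p) (Fin p) ℝ} (hW : TernaryBound W)
    {z zs : Fin p → ℝ} (hz : IsLabel z) (hzs : IsLabel zs) {s : ℝ} (hs : s = 1 ∨ s = -1)
    (T : Finset (Fin p)) {b : ℝ} (hb : 16 * √(p : ℝ) ≤ b)
    (hT : ∀ j ∈ T, b ≤ -(s * zs j) * (W *ᵥ (z - zs)) j) (hp : 0 < p) :
    (T.card : ℝ) ≤ mismatch z zs / 2 := by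
  classical
  -- A signed indicator of `T` sums the assumed inequalities; halving `z - zs` makes it ternary.
  let u : Fin p → ℝ := fun j => if j ∈ T then -(s * zs j) else 0
  let v : Fin p → ℝ := (1 / 2 : ℝ) • (z - zs)
  have hu : u ∈ ternary p := by
    rw [ternary, Fintype.mem_piFinset]
    intro j
    simp only [u]
    split_ifs
    · rcases hs with h | h <;> rcases hzs j with h' | h' <;> simp [h, h']
    · simp
  have hv : v ∈ ternary p := by
    rw [ternary, Fintype.mem_piFinset]
    intro j
    simp only [v, Pi.smul_apply, Pi.sub_apply, smul_eq_mul]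
    rcases hz j with h | h <;> rcases hzs j with h' | h' <;> rw [h, h'] <;> norm_num
  have hus : sqNorm u = T.card := by
    have : ∀ j, u j ^ 2 = if j ∈ T then 1 else 0 := by
      intro j
      simp only [u]
      split_ifs
      · rcases hs with h | h <;> rcases hzs j with h' | h' <;> simp [h, h']
      · simp
    simp [sqNorm, this]
  have hvs : sqNorm v = mismatch z zs := by
    rw [mismatch_eq_sum, sqNorm]
    refine Finset.sum_congr rfl fun j _ => ?_
    simp only [v, Pi.smul_apply, Pi.sub_apply, smul_eq_mul, mul_pow, hz.sq_sub hzs]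
    ring
  have hlow : T.card * (b / 2) ≤ u ⬝ᵥ W *ᵥ v := by
    have e : u ⬝ᵥ W *ᵥ v = ∑ j ∈ T, (-(s * zs j) * (W *ᵥ (z - zs)) j) / 2 := by
      simp only [u, v, mulVec_smul, dotProduct, Pi.smul_apply, smul_eq_mul, ite_mul, zero_mul]
      rw [Finset.sum_ite_mem, Finset.univ_inter]
      exact Finset.sum_congr rfl fun j _ => by ring
    rw [e, ← nsmul_eq_mul]
    refine Finset.card_nsmul_le_sum _ _ _ fun j hj => ?_
    linarith [hT j hj]
  have hup := hlow.trans (hW u hu v hv)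
  rw [hus, hvs] at hup
  have hp' : 0 < √(p : ℝ) := Real.sqrt_pos.2 (by exact_mod_cast hp)
  have ha := Real.sq_sqrt (Nat.cast_nonneg T.card : (0 : ℝ) ≤ T.card)
  have hb' := Real.sq_sqrt (mismatch_nonneg z zs)
  set α := √(T.card : ℝ)
  set β := √(mismatch z zs)
  have hα : 0 ≤ α := Real.sqrt_nonneg _
  have hβ : 0 ≤ β := Real.sqrt_nonneg _
  rw [← ha] at hup ⊢
  rw [← hb']
  have h1 : √(p : ℝ) * (8 * α ^ 2) ≤ √(p : ℝ) * (4 * (α * β)) := by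
    have : α ^ 2 * (16 * √(p : ℝ) / 2) ≤ α ^ 2 * (b / 2) := by gcongr
    linarith
  have h2 := le_of_mul_le_mul_left h1 hp'
  -- From `2α² ≤ αβ ≤ (α² + β²)/2`, with no division by `α`, which may be zero.
  nlinarith [sq_nonneg (α - β)]

open Classical in
/-- One step of the algorithm, from an iterate with at most `ε p` errors. -/
lemma IsUpdate.mismatch_le {lam : ℝ} {zs : Fin p → ℝ} (hzs : IsLabel zs)
    {W : Matrix (Fin p) (Fin p) ℝ} (hsymm : ∀ i j, W i j = W j i) (hW : TernaryBound W)
    {z z' : Fin p → ℝ} (hz : IsLabel z) (h : IsUpdate (observation lam zs W) z z')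
    {s : ℝ} (hs : s = 1 ∨ s = -1) (hslam : s * lam = |lam|) (hp : 0 < p)
    {δ : ℝ} (hδ : δ ≤ 1 / 2) (hδm : 32 ≤ δ * (√(p : ℝ) * |lam|))
    (hmis : mismatch z zs ≤ δ / 4 * p) :
    mismatch z' zs ≤ exceedCount s zs ((1 - δ) * (|lam| * p)) W + mismatch z zs / 2 := by
  have hp' : (0 : ℝ) < p := by exact_mod_cast hp
  have hs2 : s ^ 2 = 1 := by rcases hs with h | h <;> simp [h]
  have hsq := Real.sq_sqrt hp'.le
  have hlam : 0 ≤ |lam| := abs_nonneg _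
  have hδ0 : 0 < δ := by
    by_contra hneg
    have : δ * (√(p : ℝ) * |lam|) ≤ 0 :=
      mul_nonpos_of_nonpos_of_nonneg (not_lt.1 hneg) (by positivity)
    linarith
  have hm : 64 ≤ √(p : ℝ) * |lam| := by
    have : δ * (√(p : ℝ) * |lam|) ≤ 1 / 2 * (√(p : ℝ) * |lam|) := by gcongr
    linarith
  have hdot : (1 - δ / 2) * p ≤ zs ⬝ᵥ z := by
    rw [hz.dotProduct_eq hzs]
    linarith
  have hdot' : 3 / 4 * p ≤ zs ⬝ᵥ z := le_trans (by gcongr; linarith) hdot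
  -- The signal is at least `(9/16) · 64 · p√p = 36 p√p`, against noise at most `4 p√p`.
  have hsign : 0 < s * (z ⬝ᵥ observation lam zs W *ᵥ z) := by
    have hnoise : -(4 * √(p : ℝ) * p) ≤ s * (z ⬝ᵥ W *ᵥ z) := by
      have hneg : -s • z ∈ ternary p := by
        refine IsLabel.mem_ternary fun j => ?_
        rcases hs with h | h <;> rcases hz j with h' | h' <;> simp [h, h']
      have h1 := hW _ hneg z hz.mem_ternary
      have h2 : sqNorm (-s • z) = p := by
        rw [← hz.sqNorm_eq]
        simp [sqNorm, mul_pow, hs2]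
      rw [h2, hz.sqNorm_eq, Real.mul_self_sqrt hp'.le, smul_dotProduct, smul_eq_mul] at h1
      linarith
    rw [dotProduct_observation_mulVec, mul_add, ← mul_assoc, hslam]
    have h3 : (3 / 4 * p : ℝ) ^ 2 ≤ (zs ⬝ᵥ z) ^ 2 := by gcongr
    have h4 : |lam| * (3 / 4 * p) ^ 2 ≤ |lam| * (zs ⬝ᵥ z) ^ 2 := by gcongr
    have h5 : |lam| * (3 / 4 * p) ^ 2 = 9 / 16 * (√(p : ℝ) * |lam|) * (√(p : ℝ) * p) := by
      nth_rewrite 1 [← hsq]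
      nth_rewrite 4 [← hsq]
      ring
    have h6 : 9 / 16 * 64 * (√(p : ℝ) * p) ≤
        9 / 16 * (√(p : ℝ) * |lam|) * (√(p : ℝ) * p) := by gcongr
    have h7 : 0 < √(p : ℝ) * p := by positivity
    linarith
  let T : Finset (Fin p) := Finset.univ.filter fun j =>
    δ / 2 * (|lam| * p) ≤ -(s * zs j) * (W *ᵥ (z - zs)) j
  have hTcard : (T.card : ℝ) ≤ mismatch z zs / 2 := by
    refine hW.card_le hz hzs hs T (b := δ / 2 * (|lam| * p)) ?_
      (fun j hj => (Finset.mem_filter.1 hj).2) hp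
    calc 16 * √(p : ℝ) = 32 * (√(p : ℝ) / 2) := by ring
      _ ≤ δ * (√(p : ℝ) * |lam|) * (√(p : ℝ) / 2) := by gcongr
      _ = δ / 2 * (|lam| * √(p : ℝ) ^ 2) := by ring
      _ = _ := by rw [hsq]
  have hsub : (Finset.univ.filter fun j => z' j ≠ zs j) ⊆
      (Finset.univ.filter fun j => (1 - δ) * (|lam| * p) ≤ -(s * zs j) * (W *ᵥ zs) j) ∪ T := by
    intro j hj
    have hne := (Finset.mem_filter.1 hj).2
    have hz'j : z' j = -zs j := by
      rcases h.isLabel j with h1 | h1 <;> rcases hzs j with h2 | h2 <;> simp_all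
    have h1 := h.nonneg hsign j
    rw [sum_observation_mul hsymm, hz'j] at h1
    have h2 : s * -zs j * (lam * zs j * zs ⬝ᵥ z + (W *ᵥ z) j) =
        -(|lam| * (zs ⬝ᵥ z)) + -(s * zs j) * (W *ᵥ zs) j +
          -(s * zs j) * (W *ᵥ (z - zs)) j := by
      rw [mulVec_sub, Pi.sub_apply, ← hslam]
      linear_combination (-(s * lam * (zs ⬝ᵥ z))) * hzs.sq_eq_one j
    rw [h2] at h1
    have h3 : |lam| * ((1 - δ / 2) * p) ≤ |lam| * (zs ⬝ᵥ z) := by gcongr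
    simp only [Finset.mem_union, Finset.mem_filter, Finset.mem_univ, true_and, T]
    by_contra hcon
    push Not at hcon
    linarith [hcon.1, hcon.2]
  have hcard := (Finset.card_le_card hsub).trans (Finset.card_union_le _ _)
  have : mismatch z' zs ≤ exceedCount s zs ((1 - δ) * (|lam| * p)) W + T.card := by
    rw [mismatch, exceedCount]
    exact_mod_cast hcard
  linarith

/-! ### Non-asymptotic contraction -/

lemma IsLabel.loss_le {p : ℕ} {z zs : Fin p → ℝ} (hz : IsLabel z) (hzs : IsLabel zs) (lam : ℝ) :
    loss lam z zs ≤ p * (4 * (p * lam ^ 2)) := by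
  rw [hz.loss_eq hzs]
  have := mul_le_mul_of_nonneg_left (mismatch_le z zs) (by positivity : 0 ≤ 4 * (p * lam ^ 2))
  linarith

lemma loss_nonneg {p : ℕ} (lam : ℝ) (z zs : Fin p → ℝ) : 0 ≤ loss lam z zs :=
  Finset.sum_nonneg fun _ _ => sqNorm_nonneg _

/-- Non-asymptotic form of the convergence guarantee. -/
theorem measureReal_contraction_ge {p : ℕ} (hp : 0 < p) {lam : ℝ} {δ τ R : ℝ} (hδ : δ ≤ 1 / 2)
    (hδm : 32 ≤ δ * (√(p : ℝ) * |lam|)) (hτ : τ ≤ δ * (p * (p * lam ^ 2)))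
    (hK : Real.exp (√(p * lam ^ 2) - (1 - δ) ^ 2 * (p * lam ^ 2 / 2)) ≤ δ / 8)
    (hR : 4 * (p * lam ^ 2) *
      Real.exp (√(p * lam ^ 2) - (1 - δ) ^ 2 * (p * lam ^ 2 / 2)) ≤ R)
    {zs : Fin p → ℝ} (hzs : IsLabel zs) {Ω : Type*} [MeasurableSpace Ω] {μ : Measure Ω}
    [IsProbabilityMeasure μ] {W : Ω → Matrix (Fin p) (Fin p) ℝ} (hW : IsGaussianNoise μ W)
    {z : ℕ → Ω → Fin p → ℝ} (hz0 : ∀ ω, IsLabel (z 0 ω))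
    (hstep : ∀ t ω, IsUpdate (observation lam zs (W ω)) (z t ω) (z (t + 1) ω))
    {η : ℝ} (hη : 1 - η ≤ μ.real {ω | loss lam (z 0 ω) zs ≤ τ}) :
    1 - η - Real.exp (-√(p * lam ^ 2)) - Real.exp (-(p : ℝ)) ≤
      μ.real {ω | ∀ t : ℕ, 1 ≤ t →
        loss lam (z t ω) zs ≤ p * R + 1 / 2 * loss lam (z (t - 1) ω) zs} := by
  have hp' : (0 : ℝ) < p := by exact_mod_cast hp
  set x : ℝ := p * lam ^ 2 with hx
  have hx0 : 0 ≤ x := by positivity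
  have hxpos : 0 < x := by
    refine hx0.lt_of_ne' fun h => ?_
    have : lam = 0 := by simpa [hp.ne', hx] using h
    rw [this] at hδm
    norm_num at hδm
  obtain ⟨s, hs, hslam⟩ : ∃ s : ℝ, (s = 1 ∨ s = -1) ∧ s * lam = |lam| := by
    rcases le_total 0 lam with h | h
    · exact ⟨1, Or.inl rfl, by rw [abs_of_nonneg h, one_mul]⟩
    · exact ⟨-1, Or.inr rfl, by rw [abs_of_nonpos h, neg_one_mul]⟩
  have hs2 : s ^ 2 = 1 := by rcases hs with h | h <;> simp [h]
  set b : ℝ := (1 - δ) * (|lam| * p) with hb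
  have hb0 : 0 ≤ b := mul_nonneg (by linarith) (by positivity)
  have hbx : b ^ 2 / (2 * p) = (1 - δ) ^ 2 * (x / 2) := by
    rw [hb, mul_pow, mul_pow, sq_abs, hx]
    field_simp
  set K := Real.exp (√x - (1 - δ) ^ 2 * (x / 2)) with hKdef
  have hlabel (t : ℕ) (ω : Ω) : IsLabel (z t ω) := by
    cases t with
    | zero => exact hz0 ω
    | succ t => exact (hstep t ω).isLabel
  have hA := hW.measureReal_not_ternaryBound_le
  -- The choice `y = √x` yields the failure probability `exp(-√x)`.
  have hB := hW.measureReal_exceedCount_ge_le hzs hs2 hb0 hp (√x)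
  rw [hbx, ← hKdef] at hB
  have hsub : {ω | loss lam (z 0 ω) zs ≤ τ} ⊆
      {ω | ∀ t : ℕ, 1 ≤ t → loss lam (z t ω) zs ≤ p * R + 1 / 2 * loss lam (z (t - 1) ω) zs} ∪
        {ω | p * K ≤ exceedCount s zs b (W ω)} ∪ {ω | ¬ TernaryBound (W ω)} := by
    intro ω hω
    by_cases hT : TernaryBound (W ω)
    swap
    · exact Or.inr hT
    by_cases hS : p * K ≤ exceedCount s zs b (W ω)
    · exact Or.inl (Or.inr hS)
    refine Or.inl (Or.inl ?_)
    rw [not_le] at hS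
    have hone (t : ℕ) (ht : mismatch (z t ω) zs ≤ δ / 4 * p) :
        mismatch (z (t + 1) ω) zs ≤ p * K + mismatch (z t ω) zs / 2 := by
      have := (hstep t ω).mismatch_le hzs (hW.symm ω) hT (hlabel t ω) hs hslam hp hδ hδm ht
      linarith
    -- The invariant closes because `δ/8 + (δ/4)/2 = δ/4`.
    have hall (t : ℕ) : mismatch (z t ω) zs ≤ δ / 4 * p := by
      induction t with
      | zero =>
        have h1 : loss lam (z 0 ω) zs ≤ τ := hω
        rw [(hz0 ω).loss_eq hzs, ← hx] at h1
        have h2 : x * mismatch (z 0 ω) zs ≤ x * (δ / 4 * p) := by linarith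
        exact le_of_mul_le_mul_left h2 hxpos
      | succ t ih =>
        have h1 : (p : ℝ) * K ≤ p * (δ / 8) := by gcongr
        linarith [hone t ih]
    intro t ht
    obtain ⟨t, rfl⟩ := Nat.exists_eq_add_of_le' ht
    rw [Nat.add_sub_cancel, (hlabel _ ω).loss_eq hzs, (hlabel _ ω).loss_eq hzs, ← hx]
    calc 4 * x * mismatch (z (t + 1) ω) zs ≤ 4 * x * (p * K + mismatch (z t ω) zs / 2) := by
          gcongr
          exact hone t (hall t)
      _ = p * (4 * x * K) + 1 / 2 * (4 * x * mismatch (z t ω) zs) := by ring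
      _ ≤ _ := by gcongr
  have h1 := measureReal_mono (μ := μ) hsub
  have h2 := h1.trans (measureReal_union_le _ _)
  have h3 := h2.trans (add_le_add_left (measureReal_union_le _ _) _)
  linarith

/-! ### The vanishing error in the exponent -/

/-- The proportion of mismatches, up to a constant, below which the algorithm contracts. -/
noncomputable def radius (p lam τ : ℝ) : ℝ :=
  |τ / (p ^ 2 * lam ^ 2)| + 32 / √(p * lam ^ 2)

open Classical in
/-- The `o(1)` term in the exponent of the error bound. -/
noncomputable def exponentError (p lam τ : ℝ) : ℝ :=
  if 0 < p * lam ^ 2 ∧ radius p lam τ ≤ 1 / 2 then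
    (1 - radius p lam τ) ^ 2 - 1 - 2 / √(p * lam ^ 2)
      - 8 * (Real.log (4 * (p * lam ^ 2)) / (4 * (p * lam ^ 2)))
  -- With `-9` the exponent becomes `4x`, and `loss ≤ 4xp ≤ p exp(4x)` holds for any labels.
  else -9

lemma tendsto_radius {p lam τ : ℕ → ℝ} (hsnr : Tendsto (fun n => p n * lam n ^ 2) atTop atTop)
    (hτ : τ =o[atTop] fun n => p n ^ 2 * lam n ^ 2) :
    Tendsto (fun n => radius (p n) (lam n) (τ n)) atTop (𝓝 0) := by
  have h1 := hτ.tendsto_div_nhds_zero.abs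
  have h2 : Tendsto (fun n => 32 / √(p n * lam n ^ 2)) atTop (𝓝 0) :=
    (Real.tendsto_sqrt_atTop.comp hsnr).const_div_atTop 32
  simpa [radius] using h1.add h2

lemma tendsto_exponentError {p lam τ : ℕ → ℝ}
    (hsnr : Tendsto (fun n => p n * lam n ^ 2) atTop atTop)
    (hτ : τ =o[atTop] fun n => p n ^ 2 * lam n ^ 2) :
    Tendsto (fun n => exponentError (p n) (lam n) (τ n)) atTop (𝓝 0) := by
  have hrad := tendsto_radius hsnr hτ
  have h1 : Tendsto (fun n => 2 / √(p n * lam n ^ 2)) atTop (𝓝 0) :=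
    (Real.tendsto_sqrt_atTop.comp hsnr).const_div_atTop 2
  have h2 : Tendsto (fun n => Real.log (4 * (p n * lam n ^ 2)) / (4 * (p n * lam n ^ 2))) atTop
      (𝓝 0) :=
    Real.isLittleO_log_id_atTop.tendsto_div_nhds_zero.comp (hsnr.const_mul_atTop four_pos)
  have h3 := (((((hrad.const_sub 1).pow 2).sub_const 1).sub h1).sub (h2.const_mul 8))
  have h4 : Tendsto (fun n => (1 - radius (p n) (lam n) (τ n)) ^ 2 - 1 - 2 / √(p n * lam n ^ 2)
      - 8 * (Real.log (4 * (p n * lam n ^ 2)) / (4 * (p n * lam n ^ 2)))) atTop (𝓝 0) := by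
    simpa using h3
  refine h4.congr' ?_
  filter_upwards [hsnr.eventually_gt_atTop 0,
    hrad.eventually_le_const (by norm_num : (0 : ℝ) < 1 / 2)] with n hn hn'
  rw [exponentError, if_pos ⟨hn, hn'⟩]

/-- After multiplication by `x/2`, the term `2/√x` becomes `√x` and the logarithmic term becomes
`log(4x)`, which is the prefactor. -/
lemma exp_exponentError {p lam τ : ℝ} (hx : 0 < p * lam ^ 2) (hδ : radius p lam τ ≤ 1 / 2) :
    Real.exp (-(1 + exponentError p lam τ) * (p * lam ^ 2 / 2)) =
      4 * (p * lam ^ 2) *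
        Real.exp (√(p * lam ^ 2) - (1 - radius p lam τ) ^ 2 * (p * lam ^ 2 / 2)) := by
  rw [exponentError, if_pos ⟨hx, hδ⟩]
  set x := p * lam ^ 2
  have hsq := Real.sq_sqrt hx.le
  refine Eq.trans ?_ (congrArg (· * _) (Real.exp_log (show 0 < 4 * x by positivity)))
  rw [← Real.exp_add]
  congr 1
  have h1 : 2 / √x * x = 2 * √x := by
    nth_rewrite 2 [← hsq]
    field_simp
  have h2 : Real.log (4 * x) / (4 * x) * x = Real.log (4 * x) / 4 := by
    field_simp
  linear_combination h1 / 2 + 4 * h2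

/-- The tail bound at the signal-to-noise ratio `m ^ 2` is below the contraction radius. -/
lemma exp_sub_le_of_le {m δ : ℝ} (hm : 0 < m) (hδm : 32 / m ≤ δ) (hδ : δ ≤ 1 / 2) :
    Real.exp (m - (1 - δ) ^ 2 * (m ^ 2 / 2)) ≤ δ / 8 := by
  have hm64 : 64 ≤ m := by
    have := hδm.trans hδ
    rw [div_le_iff₀ hm] at this
    linarith
  -- Here `(1 - δ)² ≥ 1/4`, and `m ≥ 64` gives `m²/8 ≥ 8m`.
  have h1 : m - (1 - δ) ^ 2 * (m ^ 2 / 2) ≤ -m := by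
    have : (1 / 2) ^ 2 * (m ^ 2 / 2) ≤ (1 - δ) ^ 2 * (m ^ 2 / 2) := by
      gcongr
      linarith
    nlinarith
  calc _ ≤ Real.exp (-m) := Real.exp_le_exp.2 h1
    _ = (Real.exp m)⁻¹ := Real.exp_neg m
    _ ≤ m⁻¹ := by
      gcongr
      linarith [Real.add_one_le_exp m]
    _ ≤ 32 / m / 8 := by
      rw [inv_eq_one_div, div_div, div_le_div_iff₀ hm (by positivity)]
      linarith
    _ ≤ δ / 8 := by gcongr

end Z2Sync

/-! ### The asymptotic theorem -/

theorem theorem9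
    (p : ℕ → ℕ) (lam : ℕ → ℝ)
    (hsnr : Tendsto (fun n => (p n : ℝ) * lam n ^ 2) atTop atTop)
    (τ : ℕ → ℝ) (hτ : τ =o[atTop] fun n => (p n : ℝ) ^ 2 * lam n ^ 2) :
    ∃ r : ℕ → ℝ, Tendsto r atTop (𝓝 0) ∧
      ∀ (n : ℕ) (zs : Fin (p n) → ℝ), Z2Sync.IsLabel zs →
      ∀ (Ω : Type*) [MeasurableSpace Ω] (μ : Measure Ω) [IsProbabilityMeasure μ]
        (W : Ω → Matrix (Fin (p n)) (Fin (p n)) ℝ), Z2Sync.IsGaussianNoise μ W →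
      ∀ (z : ℕ → Ω → Fin (p n) → ℝ), (∀ t, Measurable (z t)) →
        (∀ ω, Z2Sync.IsLabel (z 0 ω)) →
        (∀ t ω, Z2Sync.IsUpdate (Z2Sync.observation (lam n) zs (W ω)) (z t ω) (z (t + 1) ω)) →
      ∀ η : ℝ, 1 - η ≤ μ.real {ω | Z2Sync.loss (lam n) (z 0 ω) zs ≤ τ n} →
        1 - η - Real.exp (-√((p n : ℝ) * lam n ^ 2)) - Real.exp (-(p n : ℝ)) ≤
          μ.real {ω | ∀ t : ℕ, 1 ≤ t →
            Z2Sync.loss (lam n) (z t ω) zs ≤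
              (p n : ℝ) * Real.exp (-(1 + r n) * ((p n : ℝ) * lam n ^ 2 / 2))
                + 1 / 2 * Z2Sync.loss (lam n) (z (t - 1) ω) zs} := by
  refine ⟨fun n => Z2Sync.exponentError (p n) (lam n) (τ n),
    Z2Sync.tendsto_exponentError hsnr hτ, ?_⟩
  intro n zs hzs Ω _ μ _ W hW z _ hz0 hstep η hη
  by_cases hgood : 0 < (p n : ℝ) * lam n ^ 2 ∧ Z2Sync.radius (p n) (lam n) (τ n) ≤ 1 / 2
  · obtain ⟨hx, hδ⟩ := hgood
    have hp : 0 < p n := Nat.pos_of_ne_zero fun h => by simp [h] at hx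
    have hp' : (0 : ℝ) < p n := by exact_mod_cast hp
    have hm := Real.sqrt_pos.2 hx
    have hrad : 32 / √((p n : ℝ) * lam n ^ 2) ≤ Z2Sync.radius (p n) (lam n) (τ n) :=
      le_add_of_nonneg_left (abs_nonneg _)
    refine Z2Sync.measureReal_contraction_ge hp hδ ?_ ?_ ?_ (Z2Sync.exp_exponentError hx hδ).ge
      hzs hW hz0 hstep hη
    · rw [div_le_iff₀ hm] at hrad
      rwa [Real.sqrt_mul hp'.le, Real.sqrt_sq_eq_abs] at hrad
    · have hpos : 0 < (p n : ℝ) ^ 2 * lam n ^ 2 := by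
        have := mul_pos hp' hx
        linarith
      have h1 : |τ n / ((p n : ℝ) ^ 2 * lam n ^ 2)| ≤ Z2Sync.radius (p n) (lam n) (τ n) :=
        le_add_of_nonneg_right (by positivity)
      have h2 := (div_le_iff₀ hpos).1 ((le_abs_self _).trans h1)
      linarith
    · have := Z2Sync.exp_sub_le_of_le hm hrad hδ
      rwa [Real.sq_sqrt hx.le] at this
  · have hlabel (t : ℕ) (ω : Ω) : Z2Sync.IsLabel (z t ω) := by
      cases t with
      | zero => exact hz0 ω
      | succ t => exact (hstep t ω).isLabel
    have huniv : {ω | ∀ t : ℕ, 1 ≤ t → Z2Sync.loss (lam n) (z t ω) zs ≤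
        (p n : ℝ) * Real.exp (-(1 + Z2Sync.exponentError (p n) (lam n) (τ n)) *
          ((p n : ℝ) * lam n ^ 2 / 2)) + 1 / 2 * Z2Sync.loss (lam n) (z (t - 1) ω) zs} =
        Set.univ := by
      refine Set.eq_univ_of_forall fun ω t _ => ?_
      have h1 := (hlabel t ω).loss_le hzs (lam n)
      have h2 := Z2Sync.loss_nonneg (lam n) (z (t - 1) ω) zs
      have h3 : -(1 + Z2Sync.exponentError (p n) (lam n) (τ n)) * ((p n : ℝ) * lam n ^ 2 / 2) =
          4 * ((p n : ℝ) * lam n ^ 2) := by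
        rw [Z2Sync.exponentError, if_neg hgood]
        ring
      have h4 := Real.add_one_le_exp (4 * ((p n : ℝ) * lam n ^ 2))
      have h5 : (p n : ℝ) * (4 * ((p n : ℝ) * lam n ^ 2)) ≤
          p n * Real.exp (4 * ((p n : ℝ) * lam n ^ 2)) := by
        gcongr
        linarith
      rw [h3]
      linarith
    rw [huniv, probReal_univ]
    have h1 := hη.trans measureReal_le_one
    -- The level `1 - η` is below a probability, so `η` cannot be negative.
    have h0 : 0 ≤ η := by linarith
    linarith [Real.exp_pos (-√((p n : ℝ) * lam n ^ 2)), Real.exp_pos (-(p n : ℝ))]
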